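/- Let $\mathbb{K}$ be a field of characteristic $0$ and let $L=(L,d,[-,-])$ be a ($\mathbb{Z}$-graded) differential graded Lie algebra over $\mathbb{K}$, with $d$ of degree $+1$. For a local Artin $\mathbb{K}$-algebra $A$ with residue field $\mathbb{K}$ and maximal ideal $\mathfrak{m}_A$ put \[ \operatorname{Def}_L(A)=\frac{\{x\in L^1\otimes\mathfrak{m}_A\mid dx+\frac12[x,x]=0\}}{\text{gauge action of }\exp(L^0\otimes\mathfrak{m}_A)},\qquad e^a\ast x=x+\sum_{n\ge 0}\frac{[a,-]^n}{(n+1)!}([a,x]-da), \] a functor of $A$, and put $\operatorname{Def}_L(\mathbb{K}[[t]]):=\varprojlim_{n\ge 1}\operatorname{Def}_L(\mathbb{K}[t]/(t^n))$. Suppose that $L$ is formal, i.e. that there exist DG-Lie algebras $M$ and $H$ over $\mathbb{K}$, with $H$ having trivial differential, and quasi-isomorphisms of DG-Lie algebras $L\leftarrow M\to H$. Then the two natural maps \[ \operatorname{Def}_L(\mathbb{K}[t]/(t^3))\to\operatorname{Def}_L(\mathbb{K}[t]/(t^2)),\qquad \operatorname{Def}_L(\mathbb{K}[[t]])\to\operatorname{Def}_L(\mathbb{K}[t]/(t^2))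 \] have the same image. -/

import Mathlib

open scoped TensorProduct Polynomial

universe u v w w₁ w₂

/-- A differential graded Lie algebra over `K`: a `ℤ`-graded vector space (given as an internal
direct sum), a differential of degree `+1` and a graded Lie bracket of degree `0`. -/
structure DGLieAlgebra (K : Type u) [Field K] where
  /-- The total space, the direct sum of all the homogeneous components. -/
  carrier : Type v
  [addCommGroup : AddCommGroup carrier]
  [module : Module K carrier]
  /-- The component of degree `i`. -/
  deg : ℤ → Submodule K carrier
  isInternal : DirectSum.IsInternal deg
  /-- The differential. -/
  d : carrier →ₗ[K] carrier
  d_mem : ∀ (i : ℤ) (x : carrier), x ∈ deg i → d x ∈ deg (i + 1)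
  d_d : ∀ x : carrier, d (d x) = 0
  /-- The bracket. -/
  bracket : carrier →ₗ[K] carrier →ₗ[K] carrier
  bracket_mem : ∀ (i j : ℤ) (x y : carrier), x ∈ deg i → y ∈ deg j →
    bracket x y ∈ deg (i + j)
  bracket_skew : ∀ (i j : ℤ) (x y : carrier), x ∈ deg i → y ∈ deg j →
    bracket x y = -((i * j).negOnePow • bracket y x)
  jacobi : ∀ (i j : ℤ) (x y z : carrier), x ∈ deg i → y ∈ deg j →
    bracket x (bracket y z) = bracket (bracket x y) z + (i * j).negOnePow • bracket y (bracket x z)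
  leibniz : ∀ (i : ℤ) (x y : carrier), x ∈ deg i →
    d (bracket x y) = bracket (d x) y + i.negOnePow • bracket x (d y)

namespace DGLieAlgebra

attribute [instance] DGLieAlgebra.addCommGroup DGLieAlgebra.module

variable {K : Type u} [Field K]

/-! ### Cohomology, quasi-isomorphisms and formality -/

/-- The space of cocycles of degree `i`. -/
def cocycles (L : DGLieAlgebra.{u, v} K) (i : ℤ) : Submodule K L.carrier :=
  L.deg i ⊓ LinearMap.ker L.d

/-- The space of coboundaries of degree `i`. -/
def coboundaries (L : DGLieAlgebra.{u, v} K) (i : ℤ) : Submodule K L.carrier :=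
  (L.deg (i - 1)).map L.d

/-- The cohomology `H^i(L)`. -/
abbrev Cohomology (L : DGLieAlgebra.{u, v} K) (i : ℤ) : Type v :=
  L.cocycles i ⧸ (L.coboundaries i).submoduleOf (L.cocycles i)

/-- A morphism of DG-Lie algebras. -/
structure Hom (L : DGLieAlgebra.{u, v} K) (M : DGLieAlgebra.{u, w} K) where
  /-- The underlying linear map. -/
  toLin : L.carrier →ₗ[K] M.carrier
  map_deg : ∀ (i : ℤ) (x : L.carrier), x ∈ L.deg i → toLin x ∈ M.deg i
  map_d : ∀ x : L.carrier, toLin (L.d x) = M.d (toLin x)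
  map_bracket : ∀ x y : L.carrier, toLin (L.bracket x y) = M.bracket (toLin x) (toLin y)

namespace Hom

variable {L : DGLieAlgebra.{u, v} K} {M : DGLieAlgebra.{u, w} K}

theorem map_cocycles (f : Hom L M) (i : ℤ) (x : L.carrier) (hx : x ∈ L.cocycles i) :
    f.toLin x ∈ M.cocycles i := by
  refine ⟨f.map_deg i x hx.1, ?_⟩
  have h : L.d x = 0 := hx.2
  change M.d (f.toLin x) = 0
  rw [← f.map_d, h, map_zero]

/-- The map induced by a morphism on cocycles. -/
def cocyclesMap (f : Hom L M) (i : ℤ) : L.cocycles i →ₗ[K] M.cocycles i :=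
  f.toLin.restrict (f.map_cocycles i)

/-- The map induced by a morphism on cohomology. -/
def cohomologyMap (f : Hom L M) (i : ℤ) : L.Cohomology i →ₗ[K] M.Cohomology i :=
  Submodule.mapQ _ _ (f.cocyclesMap i) (by
    rintro x ⟨y, hy, hyx⟩
    exact ⟨f.toLin y, f.map_deg _ _ hy, by
      rw [← f.map_d, hyx]; rfl⟩)

/-- A morphism of DG-Lie algebras is a quasi-isomorphism if it induces isomorphisms
in cohomology. -/
def IsQuasiIso (f : Hom L M) : Prop :=
  ∀ i : ℤ, Function.Bijective (f.cohomologyMap i)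

end Hom

/-- `L` is formal if there are quasi-isomorphisms of DG-Lie algebras `L ← M → H` with `H` having
trivial differential. -/
def IsFormal (L : DGLieAlgebra.{u, v} K) : Prop :=
  ∃ (M : DGLieAlgebra.{u, w₁} K) (H : DGLieAlgebra.{u, w₂} K) (f : Hom M L) (g : Hom M H),
    f.IsQuasiIso ∧ g.IsQuasiIso ∧ H.d = 0

/-! ### The DG-Lie algebra `L ⊗ A` and the gauge action -/

section Def

variable (L : DGLieAlgebra.{u, v} K) (A : Type w) [CommRing A] [Algebra K A]

/-- The differential `d ⊗ id` of `L ⊗ A`. -/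
noncomputable def tensorD : L.carrier ⊗[K] A →ₗ[K] L.carrier ⊗[K] A :=
  L.d.rTensor A

/-- The bracket of `L ⊗ A`, that is `[x ⊗ a, y ⊗ b] = [x, y] ⊗ ab`. -/
noncomputable def tensorBracket :
    L.carrier ⊗[K] A →ₗ[K] L.carrier ⊗[K] A →ₗ[K] L.carrier ⊗[K] A :=
  TensorProduct.map₂ L.bracket (LinearMap.mul K A)

/-- The subspace `L^i ⊗ 𝔪_A` of `L ⊗ A`. -/
noncomputable def tensorMax [IsLocalRing A] (i : ℤ) : Submodule K (L.carrier ⊗[K] A) :=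
  LinearMap.range (TensorProduct.map (L.deg i).subtype
    ((IsLocalRing.maximalIdeal A).restrictScalars K).subtype)

/-- The Maurer-Cartan elements `x ∈ L^1 ⊗ 𝔪_A`, `dx + [x,x]/2 = 0`. -/
def MaurerCartan [IsLocalRing A] : Type (max v w) :=
  {x : L.carrier ⊗[K] A //
    x ∈ L.tensorMax A 1 ∧ L.tensorD A x + (1 / 2 : K) • L.tensorBracket A x x = 0}

variable {A}

/-- The gauge action
`e^a * x = x + ∑ₙ [a,-]ⁿ([a,x] - da) / (n+1)!`. For `a ∈ L^0 ⊗ 𝔪_A` with `A` local Artinian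
only finitely many terms of the sum are different from zero, since `𝔪_A` is nilpotent. -/
noncomputable def gauge (a x : L.carrier ⊗[K] A) : L.carrier ⊗[K] A :=
  x + ∑ᶠ n : ℕ, ((n + 1).factorial : K)⁻¹ •
    ((L.tensorBracket A a) ^ n) (L.tensorBracket A a x - L.tensorD A a)

variable (A)

/-- Two Maurer-Cartan elements are related if some `e^a`, `a ∈ L^0 ⊗ 𝔪_A`, carries the first to
the second. -/
def GaugeRel [IsLocalRing A] (x y : L.MaurerCartan A) : Prop :=
  ∃ a ∈ L.tensorMax A 0, L.gauge a x.1 = y.1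

/-- `Def_L(A)`, for `A` a local Artin `K`-algebra: the quotient of the set of Maurer-Cartan
elements by the gauge action of `exp(L^0 ⊗ 𝔪_A)`. -/
def Def [IsLocalRing A] : Type (max v w) := Quot (L.GaugeRel A)

end Def

/-! ### Functoriality of `Def_L` -/

section Functoriality

variable (L : DGLieAlgebra.{u, v} K) {A : Type w₁} [CommRing A] [Algebra K A]
  {B : Type w₂} [CommRing B] [Algebra K B]

/-- The map `L ⊗ A → L ⊗ B` induced by `A → B`. -/
noncomputable def baseMap (φ : A →ₐ[K] B) : L.carrier ⊗[K] A →ₗ[K] L.carrier ⊗[K] B :=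
  φ.toLinearMap.lTensor L.carrier

theorem baseMap_tensorD (φ : A →ₐ[K] B) (x : L.carrier ⊗[K] A) :
    L.baseMap φ (L.tensorD A x) = L.tensorD B (L.baseMap φ x) := by
  induction x with
  | zero => simp
  | tmul x a => simp [baseMap, tensorD]
  | add x y hx hy => simp only [map_add, hx, hy]

theorem baseMap_tensorBracket (φ : A →ₐ[K] B) (x y : L.carrier ⊗[K] A) :
    L.baseMap φ (L.tensorBracket A x y) =
      L.tensorBracket B (L.baseMap φ x) (L.baseMap φ y) := by
  induction x with
  | zero => simp
  | add x x' hx hx' => simp only [map_add, LinearMap.add_apply, hx, hx']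
  | tmul x a =>
    induction y with
    | zero => simp
    | add y y' hy hy' => simp only [map_add, hy, hy']
    | tmul y b => simp [baseMap, tensorBracket]

theorem baseMap_iterate (φ : A →ₐ[K] B) (a x : L.carrier ⊗[K] A) (n : ℕ) :
    L.baseMap φ (((L.tensorBracket A a) ^ n) x) =
      ((L.tensorBracket B (L.baseMap φ a)) ^ n) (L.baseMap φ x) := by
  induction n with
  | zero => simp
  | succ n ih => simp only [pow_succ', Module.End.mul_apply, baseMap_tensorBracket, ih]

theorem isNilpotent_maximalIdeal (A : Type w₁) [CommRing A] [IsLocalRing A] [IsArtinianRing A] :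
    IsNilpotent (IsLocalRing.maximalIdeal A) := by
  have h := IsArtinianRing.isNilpotent_jacobson_bot (R := A)
  rwa [IsLocalRing.jacobson_eq_maximalIdeal ⊥ bot_ne_top] at h

theorem map_mem_maximalIdeal [IsLocalRing A] [IsArtinianRing A] [IsLocalRing B] (φ : A →ₐ[K] B)
    (a : A) (ha : a ∈ IsLocalRing.maximalIdeal A) : φ a ∈ IsLocalRing.maximalIdeal B := by
  obtain ⟨n, hn⟩ := isNilpotent_maximalIdeal A
  have h : a ^ n = 0 := by
    have := Ideal.pow_mem_pow ha n
    rwa [hn] at this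
  refine Ideal.IsPrime.mem_of_pow_mem (IsLocalRing.maximalIdeal.isMaximal B).isPrime n ?_
  rw [← map_pow, h, map_zero]
  exact Ideal.zero_mem _

theorem baseMap_mem_tensorMax [IsLocalRing A] [IsArtinianRing A] [IsLocalRing B]
    (φ : A →ₐ[K] B) (i : ℤ) (x : L.carrier ⊗[K] A) (hx : x ∈ L.tensorMax A i) :
    L.baseMap φ x ∈ L.tensorMax B i := by
  obtain ⟨y, rfl⟩ := hx
  induction y with
  | zero => simp
  | add y z hy hz => simpa only [map_add] using Submodule.add_mem _ hy hz
  | tmul y a =>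
    exact ⟨y ⊗ₜ ⟨φ a.1, map_mem_maximalIdeal φ a.1 a.2⟩, by simp [baseMap]⟩

/-- The subspace `L ⊗ I` of `L ⊗ A`. -/
noncomputable def tensorIdeal (I : Ideal A) : Submodule K (L.carrier ⊗[K] A) :=
  LinearMap.range ((I.restrictScalars K).subtype.lTensor L.carrier)

theorem bracket_mem_tensorIdeal [IsLocalRing A] (n : ℕ) (i : ℤ) (a x : L.carrier ⊗[K] A)
    (ha : a ∈ L.tensorMax A i) (hx : x ∈ L.tensorIdeal (IsLocalRing.maximalIdeal A ^ n)) :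
    L.tensorBracket A a x ∈ L.tensorIdeal (IsLocalRing.maximalIdeal A ^ (n + 1)) := by
  obtain ⟨a, rfl⟩ := ha
  obtain ⟨x, rfl⟩ := hx
  induction a with
  | zero => simp
  | add a b ha hb =>
    simpa only [map_add, LinearMap.add_apply] using Submodule.add_mem _ ha hb
  | tmul a s =>
    induction x with
    | zero => simp
    | add x y hx hy => simpa only [map_add] using Submodule.add_mem _ hx hy
    | tmul x t =>
      refine ⟨L.bracket a x ⊗ₜ ⟨s.1 * t.1, ?_⟩, by simp [tensorBracket]⟩
      change s.1 * t.1 ∈ IsLocalRing.maximalIdeal A ^ (n + 1)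
      rw [pow_succ']
      exact Ideal.mul_mem_mul s.2 t.2

theorem iterate_mem_tensorIdeal [IsLocalRing A] (n : ℕ) (i : ℤ) (a x : L.carrier ⊗[K] A)
    (ha : a ∈ L.tensorMax A i) :
    ((L.tensorBracket A a) ^ n) x ∈ L.tensorIdeal (IsLocalRing.maximalIdeal A ^ n) := by
  induction n with
  | zero =>
    induction x with
    | zero => simp
    | add x y hx hy => simpa only [map_add] using Submodule.add_mem _ hx hy
    | tmul x t => exact ⟨x ⊗ₜ ⟨t, by simp⟩, by simp⟩
  | succ n ih =>
    rw [pow_succ' (L.tensorBracket A a), Module.End.mul_apply]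
    exact L.bracket_mem_tensorIdeal n i a _ ha ih

theorem gauge_support_finite [IsLocalRing A] [IsArtinianRing A] (a y : L.carrier ⊗[K] A)
    (ha : a ∈ L.tensorMax A 0) :
    (Function.support fun n : ℕ => ((n + 1).factorial : K)⁻¹ •
      ((L.tensorBracket A a) ^ n) y).Finite := by
  obtain ⟨N, hN⟩ := isNilpotent_maximalIdeal A
  refine (Set.finite_lt_nat N).subset fun n hn => ?_
  by_contra hlt
  have hle : N ≤ n := not_lt.mp hlt
  apply hn
  have h := L.iterate_mem_tensorIdeal n 0 a y ha
  have h0 : IsLocalRing.maximalIdeal A ^ n = ⊥ :=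
    le_bot_iff.mp ((Ideal.pow_le_pow_right hle).trans hN.le)
  rw [h0] at h
  obtain ⟨z, hz⟩ := h
  have hz0 : z = 0 := by
    clear hz
    induction z with
    | zero => rfl
    | add z w hz hw => rw [hz, hw, add_zero]
    | tmul z t =>
      have : t = 0 := Subtype.ext t.2
      rw [this, TensorProduct.tmul_zero]
  rw [hz0, map_zero] at hz
  simp [← hz]

theorem baseMap_gauge [IsLocalRing A] [IsArtinianRing A] (φ : A →ₐ[K] B)
    (a x : L.carrier ⊗[K] A) (ha : a ∈ L.tensorMax A 0) :
    L.baseMap φ (L.gauge a x) = L.gauge (L.baseMap φ a) (L.baseMap φ x) := by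
  unfold gauge
  rw [map_add]
  congr 1
  have h := AddMonoidHom.map_finsum (L.baseMap φ).toAddMonoidHom
    (L.gauge_support_finite a (L.tensorBracket A a x - L.tensorD A a) ha)
  refine h.trans (finsum_congr fun n => ?_)
  change L.baseMap φ _ = _
  rw [map_smul, baseMap_iterate, map_sub, baseMap_tensorBracket, baseMap_tensorD]

variable [IsLocalRing A] [IsArtinianRing A] [IsLocalRing B]

/-- The map induced on Maurer-Cartan elements by a morphism of local Artin `K`-algebras. -/
noncomputable def MaurerCartan.map (φ : A →ₐ[K] B) (x : L.MaurerCartan A) : L.MaurerCartan B :=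
  ⟨L.baseMap φ x.1, L.baseMap_mem_tensorMax φ 1 x.1 x.2.1, by
    rw [← baseMap_tensorD, ← baseMap_tensorBracket, ← map_smul, ← map_add, x.2.2, map_zero]⟩

/-- The map `Def_L(A) → Def_L(B)` induced by a morphism of local Artin `K`-algebras. -/
noncomputable def Def.map (φ : A →ₐ[K] B) : L.Def A → L.Def B :=
  Quot.map (MaurerCartan.map L φ) (by
    rintro x y ⟨a, ha, hxy⟩
    refine ⟨L.baseMap φ a, L.baseMap_mem_tensorMax φ 0 a ha, ?_⟩
    change L.gauge (L.baseMap φ a) (L.baseMap φ x.1) = L.baseMap φ y.1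
    rw [← hxy, baseMap_gauge L φ a x.1 ha])

end Functoriality

end DGLieAlgebra

/-! ### The algebras `K[t]/(t^n)` -/

/-- The algebra `K[t]/(t^n)`. -/
abbrev TruncPoly (K : Type u) [Field K] (n : ℕ) : Type u :=
  K[X] ⧸ Ideal.span {(Polynomial.X : K[X]) ^ n}

namespace TruncPoly

variable (K : Type u) [Field K]

instance instIsArtinianRing (n : ℕ) : IsArtinianRing (TruncPoly K n) := by
  have : Module.Finite K (TruncPoly K n) := (Polynomial.monic_X_pow n).finite_quotient
  exact IsArtinianRing.of_finite K _

instance instIsLocalRing (n : ℕ) [NeZero n] : IsLocalRing (TruncPoly K n) := by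
  set I : Ideal K[X] := Ideal.span {(Polynomial.X : K[X]) ^ n} with hI
  have hX : IsNilpotent (Ideal.Quotient.mk I Polynomial.X) :=
    ⟨n, by
      rw [← map_pow, Ideal.Quotient.eq_zero_iff_mem]
      exact Ideal.mem_span_singleton_self _⟩
  have hne : I ≠ ⊤ := by
    rw [hI, Ne, Ideal.span_singleton_eq_top, isUnit_pow_iff (NeZero.ne n)]
    exact Polynomial.not_isUnit_X
  have : Nontrivial (K[X] ⧸ I) := Ideal.Quotient.nontrivial_iff.mpr hne
  have hunit : ∀ p : K[X], p.coeff 0 ≠ 0 → IsUnit (Ideal.Quotient.mk I p) := by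
    intro p hp
    have h1 : IsUnit (Ideal.Quotient.mk I (Polynomial.C (p.coeff 0))) :=
      ((isUnit_iff_ne_zero.mpr hp).map Polynomial.C).map _
    have h2 : IsNilpotent (Ideal.Quotient.mk I (Polynomial.X * p.divX)) := by
      rw [map_mul]
      exact (Commute.all _ _).isNilpotent_mul_right hX
    have h3 := h2.isUnit_add_left_of_commute h1 (Commute.all _ _)
    rwa [← map_add, add_comm, Polynomial.X_mul_divX_add] at h3
  refine IsLocalRing.of_isUnit_or_isUnit_one_sub_self fun a => ?_
  obtain ⟨p, rfl⟩ := Ideal.Quotient.mk_surjective a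
  by_cases hp : p.coeff 0 = 0
  · right
    rw [← map_one (Ideal.Quotient.mk I), ← map_sub]
    exact hunit _ (by simp [hp])
  · exact Or.inl (hunit p hp)

/-- The projection `K[t]/(t^n) → K[t]/(t^m)`, `m ≤ n`. -/
noncomputable def proj {m n : ℕ} (h : m ≤ n) : TruncPoly K n →ₐ[K] TruncPoly K m :=
  Ideal.Quotient.factorₐ K (Ideal.span_singleton_le_span_singleton.mpr (pow_dvd_pow _ h))

end TruncPoly

namespace DGLieAlgebra

variable {K : Type u} [Field K]

/-- `Def_L(K[[t]])`, the inverse limit of the sets `Def_L(K[t]/(t^n))`, `n ≥ 1`. -/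
def DefPowerSeries (L : DGLieAlgebra.{u, v} K) : Type (max u v) :=
  {s : ∀ (n : ℕ) [NeZero n], L.Def (TruncPoly K n) //
    ∀ (m n : ℕ) [NeZero m] [NeZero n] (h : m ≤ n), Def.map L (TruncPoly.proj K h) (s n) = s m}

/-- The canonical map `Def_L(K[[t]]) → Def_L(K[t]/(t^n))`. -/
def DefPowerSeries.eval (L : DGLieAlgebra.{u, v} K) (n : ℕ) [NeZero n] (s : L.DefPowerSeries) :
    L.Def (TruncPoly K n) :=
  s.1 n

end DGLieAlgebra

open Finset

/-! A point of `Def_L(K[[t]])` has a component at `t^3`, so only one inclusion has content. A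
Maurer-Cartan element `x₁ t + x₂ t²` says that `x₁` is a cocycle and `[x₁, x₁]` is exact. It is
enough to extend some `(x₁ + da) t` to a formal solution, since over `K[t]/(t^2)` the gauge action
changes the leading coefficient exactly by coboundaries (`gauge_tmul_t`).

Formality moves the problem to `M`: `x₁` lifts up to a coboundary to a cocycle `m₁`, and `[m₁, m₁]`
is exact because its image in `L` is. As `H` has zero differential, `[g m₁, g m₁] = 0` holds on the
nose, so `(g m₁) t` is already a formal solution in `H`. The core is `exists_formal_maurerCartan`,
which lifts this solution to `M` with every higher coefficient in `ker g`. Each obstruction is a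
cocycle by `d_bracketCoeff_eq_zero` and is killed by `g`, hence exact; a primitive can be corrected
by a cocycle so as to lie in `ker g` again. Applying `f` gives the series in `L`. -/

/-! ### Sequences and sums over antidiagonals -/

/-- Strong recursion: a sequence whose `n`-th term is computed from its truncation below `n`. -/
theorem exists_seq_eq_of_truncation {α : Type*} [Zero α] (step : ℕ → (ℕ → α) → α) :
    ∃ m : ℕ → α, ∀ n, m n = step n (fun i => if i < n then m i else 0) := by
  let m : ℕ → α := Nat.lt_wfRel.wf.fix (C := fun _ => α)
    fun n ih => step n (fun i => if h : i < n then ih i h else 0)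
  refine ⟨m, fun n => ?_⟩
  have h := Nat.lt_wfRel.wf.fix_eq (C := fun _ => α)
    (fun n ih => step n (fun i => if h : i < n then ih i h else 0)) n
  simpa only [dite_eq_ite] using h

/-- Both sides run over all triples with sum `n`. This lets the three cyclic terms of the Jacobi
identity be identified after summation. -/
theorem sum_antidiagonal_triple_rotate {α : Type*} [AddCommMonoid α] (n : ℕ)
    (F : ℕ → ℕ → ℕ → α) :
    ∑ p ∈ antidiagonal n, ∑ q ∈ antidiagonal p.1, F q.1 q.2 p.2 =
      ∑ p ∈ antidiagonal n, ∑ q ∈ antidiagonal p.1, F p.2 q.1 q.2 := by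
  rw [Finset.sum_sigma', Finset.sum_sigma']
  refine Finset.sum_nbij' (fun x => ⟨(x.2.2 + x.1.2, x.2.1), (x.2.2, x.1.2)⟩)
    (fun x => ⟨(x.1.2 + x.2.1, x.2.2), (x.1.2, x.2.1)⟩) ?_ ?_ ?_ ?_ ?_
  · rintro ⟨⟨i, c⟩, ⟨a, b⟩⟩ h
    simp only [mem_sigma, HasAntidiagonal.mem_antidiagonal] at h ⊢
    exact ⟨by omega, trivial⟩
  · rintro ⟨⟨i, c⟩, ⟨a, b⟩⟩ h
    simp only [mem_sigma, HasAntidiagonal.mem_antidiagonal] at h ⊢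
    exact ⟨by omega, trivial⟩
  · rintro ⟨⟨i, c⟩, ⟨a, b⟩⟩ h
    simp only [mem_sigma, HasAntidiagonal.mem_antidiagonal] at h
    obtain ⟨h1, rfl⟩ := h
    rfl
  · rintro ⟨⟨i, c⟩, ⟨a, b⟩⟩ h
    simp only [mem_sigma, HasAntidiagonal.mem_antidiagonal] at h
    obtain ⟨h1, rfl⟩ := h
    rfl
  · rintro ⟨⟨i, c⟩, ⟨a, b⟩⟩ h
    rfl

namespace DGLieAlgebra

variable {K : Type u} [Field K]

/-! ### Quasi-isomorphisms on representatives -/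

namespace Hom

variable {L : DGLieAlgebra.{u, v} K} {M : DGLieAlgebra.{u, w} K} {f : Hom L M}

/-- Surjectivity in cohomology, on representatives. -/
theorem IsQuasiIso.exists_lift (hf : f.IsQuasiIso) {i : ℤ} {z : M.carrier}
    (hz : z ∈ M.cocycles i) :
    ∃ m ∈ L.cocycles i, ∃ b ∈ M.deg (i - 1), f.toLin m = z + M.d b := by
  obtain ⟨q, hq⟩ := (hf i).2 (Submodule.Quotient.mk ⟨z, hz⟩)
  obtain ⟨m, rfl⟩ := Submodule.Quotient.mk_surjective _ q
  have h : Submodule.Quotient.mk (f.cocyclesMap i m) = Submodule.Quotient.mk ⟨z, hz⟩ := hq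
  rw [Submodule.Quotient.eq] at h
  obtain ⟨b, hb, hbz⟩ := h
  refine ⟨m.1, m.2, b, hb, ?_⟩
  rw [hbz]
  change _ = z + (f.toLin m.1 - z)
  abel

/-- Injectivity in cohomology, on representatives. -/
theorem IsQuasiIso.exists_primitive (hf : f.IsQuasiIso) {i : ℤ} {m : L.carrier}
    (hm : m ∈ L.cocycles i) {b : M.carrier} (hb : b ∈ M.deg (i - 1)) (h : f.toLin m = M.d b) :
    ∃ a ∈ L.deg (i - 1), L.d a = m := by
  have h0 : f.cohomologyMap i (Submodule.Quotient.mk ⟨m, hm⟩) = 0 := by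
    change Submodule.Quotient.mk (f.cocyclesMap i ⟨m, hm⟩) = 0
    rw [Submodule.Quotient.mk_eq_zero]
    exact ⟨b, hb, h.symm⟩
  have h1 := (hf i).1 (h0.trans (map_zero _).symm)
  rw [Submodule.Quotient.mk_eq_zero] at h1
  exact h1

end Hom

/-! ### Brackets of elements of degree one and two -/

section Degrees

variable (L : DGLieAlgebra.{u, v} K)

theorem d_mem_two {x : L.carrier} (hx : x ∈ L.deg 1) : L.d x ∈ L.deg 2 :=
  L.d_mem 1 x hx

theorem bracket_mem_two {x y : L.carrier} (hx : x ∈ L.deg 1) (hy : y ∈ L.deg 1) :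
    L.bracket x y ∈ L.deg 2 :=
  L.bracket_mem 1 1 x y hx hy

theorem bracket_comm_of_deg_one {x y : L.carrier} (hx : x ∈ L.deg 1) (hy : y ∈ L.deg 1) :
    L.bracket x y = L.bracket y x := by
  simpa using L.bracket_skew 1 1 x y hx hy

theorem bracket_two_one {x y : L.carrier} (hx : x ∈ L.deg 2) (hy : y ∈ L.deg 1) :
    L.bracket y x = -L.bracket x y := by
  have h := L.bracket_skew 1 2 y x hy hx
  rwa [one_mul, Int.negOnePow_even 2 even_two, one_smul] at h

theorem d_bracket_of_deg_one {x y : L.carrier} (hx : x ∈ L.deg 1) (hy : y ∈ L.deg 1) :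
    L.d (L.bracket x y) = L.bracket (L.d x) y + L.bracket (L.d y) x := by
  rw [L.leibniz 1 x y hx, L.bracket_two_one (L.d_mem_two hy) hx]
  simp

theorem jacobi_of_deg_one {x y z : L.carrier} (hx : x ∈ L.deg 1) (hy : y ∈ L.deg 1)
    (hz : z ∈ L.deg 1) :
    L.bracket (L.bracket x y) z + L.bracket (L.bracket y z) x +
      L.bracket (L.bracket z x) y = 0 := by
  have h := L.jacobi 1 1 z x y hz hx
  rw [L.bracket_two_one (L.bracket_mem_two hx hy) hz,
    L.bracket_two_one (L.bracket_mem_two hz hy) hx, L.bracket_comm_of_deg_one hz hy] at h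
  simp only [mul_one, Int.negOnePow_one, Units.neg_smul, one_smul, neg_neg] at h
  rw [add_assoc, add_comm (L.bracket (L.bracket y z) x), ← h, add_neg_cancel]

/-! ### Lifting formal Maurer-Cartan solutions -/

/-- The coefficient of degree `n` of `[m, m]`, for the formal series `m = ∑ mᵢ tⁱ`. -/
def bracketCoeff (m : ℕ → L.carrier) (n : ℕ) : L.carrier :=
  ∑ p ∈ antidiagonal n, L.bracket (m p.1) (m p.2)

theorem bracketCoeff_mem {m : ℕ → L.carrier} (hm : ∀ i, m i ∈ L.deg 1) (n : ℕ) :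
    L.bracketCoeff m n ∈ L.deg 2 :=
  Submodule.sum_mem _ fun _ _ => L.bracket_mem_two (hm _) (hm _)

/-- With zero constant term, only indices strictly between `0` and `n` contribute. The Maurer-Cartan
equation can therefore be solved recursively. -/
theorem bracketCoeff_congr {m m' : ℕ → L.carrier} (n : ℕ) (h0 : m 0 = 0) (h0' : m' 0 = 0)
    (h : ∀ i < n, m i = m' i) : L.bracketCoeff m n = L.bracketCoeff m' n := by
  refine Finset.sum_congr rfl fun p hp => ?_
  rw [HasAntidiagonal.mem_antidiagonal] at hp
  rcases Nat.eq_zero_or_pos p.1 with h1 | h1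
  · simp [h1, h0, h0']
  · rcases Nat.eq_zero_or_pos p.2 with h2 | h2
    · simp [h2, h0, h0']
    · rw [h p.1 (by omega), h p.2 (by omega)]

/-- The identity `[[m, m], m] = 0` for odd `m`: Jacobi gives three times the sum, and `3` is
invertible. -/
theorem sum_bracket_bracket_eq_zero [CharZero K] {m : ℕ → L.carrier} (hm : ∀ i, m i ∈ L.deg 1)
    (n : ℕ) :
    ∑ p ∈ antidiagonal n, ∑ q ∈ antidiagonal p.1,
      L.bracket (L.bracket (m q.1) (m q.2)) (m p.2) = 0 := by
  have e1 := sum_antidiagonal_triple_rotate n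
    fun a b c => L.bracket (L.bracket (m a) (m b)) (m c)
  have e2 := sum_antidiagonal_triple_rotate n
    fun a b c => L.bracket (L.bracket (m c) (m a)) (m b)
  have h : ∑ p ∈ antidiagonal n, ∑ q ∈ antidiagonal p.1,
      (L.bracket (L.bracket (m q.1) (m q.2)) (m p.2) +
        L.bracket (L.bracket (m q.2) (m p.2)) (m q.1) +
        L.bracket (L.bracket (m p.2) (m q.1)) (m q.2)) = 0 :=
    Finset.sum_eq_zero fun p _ => Finset.sum_eq_zero fun q _ =>
      L.jacobi_of_deg_one (hm _) (hm _) (hm _)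
  simp only [Finset.sum_add_distrib] at h
  rw [← e2, ← e1] at h
  have h3 : (3 : K) • ∑ p ∈ antidiagonal n, ∑ q ∈ antidiagonal p.1,
      L.bracket (L.bracket (m q.1) (m q.2)) (m p.2) = 0 := by
    rw [← h]; module
  exact (smul_eq_zero.mp h3).resolve_left (by norm_num)

/-- If `m` solves the Maurer-Cartan equation below degree `n`, the obstruction in degree `n` is
a cocycle. -/
theorem d_bracketCoeff_eq_zero [CharZero K] {m : ℕ → L.carrier} (hm : ∀ i, m i ∈ L.deg 1)
    (h0 : m 0 = 0) (n : ℕ)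
    (hd : ∀ i < n, L.d (m i) + (1 / 2 : K) • L.bracketCoeff m i = 0) :
    L.d (L.bracketCoeff m n) = 0 := by
  -- Substitute `dm = -[m, m]/2` into `d[m, m] = 2[dm, m]`. The equation in degree `n` itself is not
  -- needed, because there `p.2 = 0` and `m 0 = 0`.
  have h1 : ∀ p ∈ antidiagonal n, L.bracket (L.d (m p.1)) (m p.2) =
      -((1 / 2 : K) • ∑ q ∈ antidiagonal p.1, L.bracket (L.bracket (m q.1) (m q.2)) (m p.2)) := by
    intro p hp
    rw [HasAntidiagonal.mem_antidiagonal] at hp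
    rcases Nat.eq_zero_or_pos p.2 with h2 | h2
    · simp [h2, h0]
    · rw [eq_neg_of_add_eq_zero_left (hd p.1 (by omega))]
      simp [bracketCoeff, LinearMap.sum_apply]
  have h2 : ∑ p ∈ antidiagonal n, L.bracket (L.d (m p.1)) (m p.2) = 0 := by
    rw [Finset.sum_congr rfl h1, Finset.sum_neg_distrib, ← Finset.smul_sum,
      L.sum_bracket_bracket_eq_zero hm, smul_zero, neg_zero]
  have h3 := Finset.Nat.sum_antidiagonal_swap (n := n)
    (f := fun p => L.bracket (L.d (m p.1)) (m p.2))
  rw [bracketCoeff, map_sum,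
    Finset.sum_congr rfl fun p _ => L.d_bracket_of_deg_one (hm p.1) (hm p.2),
    Finset.sum_add_distrib, h2, zero_add]
  exact h3.trans h2

end Degrees

/-- Let `g : M → H` be a quasi-isomorphism onto a DG-Lie algebra with trivial differential, and
`m₁` a cocycle of degree one such that `[g m₁, g m₁] = 0`. Then `m₁ t` extends to a formal
Maurer-Cartan series. -/
theorem exists_formal_maurerCartan [CharZero K] {M : DGLieAlgebra.{u, v} K}
    {H : DGLieAlgebra.{u, w} K} {g : Hom M H} (hg : g.IsQuasiIso) (hH : H.d = 0)
    {m₁ : M.carrier} (hm₁ : m₁ ∈ M.cocycles 1)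
    (hsq : H.bracket (g.toLin m₁) (g.toLin m₁) = 0) :
    ∃ m : ℕ → M.carrier, m 0 = 0 ∧ m 1 = m₁ ∧ (∀ i, m i ∈ M.deg 1) ∧
      ∀ i, M.d (m i) + (1 / 2 : K) • M.bracketCoeff m i = 0 := by
  classical
  -- Inside the recursion `m` is the truncation below `n`, called `r` later. The final default `0`
  -- is never used: `key` shows that a suitable `w` always exists.
  obtain ⟨m, hm⟩ := exists_seq_eq_of_truncation (α := M.carrier) fun n m =>
    if n = 0 then 0 else if n = 1 then m₁ else
      if h : ∃ w ∈ M.deg 1, g.toLin w = 0 ∧ M.d w + (1 / 2 : K) • M.bracketCoeff m n = 0 then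
        h.choose else 0
  have m0 : m 0 = 0 := by rw [hm]; simp
  have m1 : m 1 = m₁ := by rw [hm]; simp
  have key : ∀ n, m n ∈ M.deg 1 ∧ (n ≠ 1 → g.toLin (m n) = 0) ∧
      M.d (m n) + (1 / 2 : K) • M.bracketCoeff m n = 0 := by
    intro n
    induction n using Nat.strong_induction_on with
    | _ n ih =>
    rcases Nat.lt_or_ge n 2 with hn | hn
    · interval_cases n
      · simp [m0, bracketCoeff]
      · refine ⟨m1 ▸ hm₁.1, fun h => absurd rfl h, ?_⟩
        have : M.d m₁ = 0 := hm₁.2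
        simp [m0, m1, bracketCoeff, this, Finset.Nat.antidiagonal_succ]
    · set r : ℕ → M.carrier := fun i => if i < n then m i else 0 with hr
      have r_0 : r 0 = 0 := by simp [hr, m0]
      have r_lt : ∀ i < n, r i = m i := fun i hi => by simp [hr, hi]
      have r_deg : ∀ i, r i ∈ M.deg 1 := by
        intro i
        by_cases hi : i < n
        · rw [r_lt i hi]; exact (ih i hi).1
        · simp [hr, hi]
      have r_g : ∀ i, i ≠ 1 → g.toLin (r i) = 0 := by
        intro i hi1
        by_cases hi : i < n
        · rw [r_lt i hi]; exact (ih i hi).2.1 hi1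
        · simp [hr, hi]
      have hcongr : ∀ i ≤ n, M.bracketCoeff r i = M.bracketCoeff m i := fun i hi =>
        M.bracketCoeff_congr i r_0 m0 fun j hj => r_lt j (hj.trans_le hi)
      have hcoc : M.d (M.bracketCoeff r n) = 0 := by
        refine M.d_bracketCoeff_eq_zero r_deg r_0 n fun i hi => ?_
        rw [r_lt i hi, hcongr i hi.le]
        exact (ih i hi).2.2
      -- Since `g` kills every coefficient except the first, only `[g m₁, g m₁]` could survive, and
      -- it vanishes by `hsq`.
      have hgo : g.toLin (M.bracketCoeff r n) = H.d 0 := by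
        rw [bracketCoeff, map_sum, map_zero]
        refine Finset.sum_eq_zero fun p hp => ?_
        rw [HasAntidiagonal.mem_antidiagonal] at hp
        rw [g.map_bracket]
        by_cases h1 : p.1 = 1
        · by_cases h2 : p.2 = 1
          · rw [h1, h2, r_lt 1 (by omega), m1, hsq]
          · rw [r_g _ h2, map_zero]
        · rw [r_g _ h1, map_zero, LinearMap.zero_apply]
      obtain ⟨w, hw, hdw⟩ := hg.exists_primitive (i := 2) ⟨M.bracketCoeff_mem r_deg n, hcoc⟩
        (Submodule.zero_mem _) hgo
      have hw1 : w ∈ M.deg 1 := hw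
      -- The primitive `w` need not lie in `ker g`. As `H.d = 0`, `g w` is a cocycle and lifts
      -- exactly to a cocycle `c`; subtracting `c` leaves `dw` unchanged.
      obtain ⟨c, hc, b, -, hgc⟩ := hg.exists_lift (i := 1) (z := g.toLin w)
        ⟨g.map_deg 1 w hw1, by simp [hH]⟩
      rw [hH, LinearMap.zero_apply, add_zero] at hgc
      have hdc : M.d c = 0 := hc.2
      have hex : ∃ w ∈ M.deg 1, g.toLin w = 0 ∧
          M.d w + (1 / 2 : K) • M.bracketCoeff r n = 0 := by
        refine ⟨(1 / 2 : K) • (c - w), Submodule.smul_mem _ _ (Submodule.sub_mem _ hc.1 hw1),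
          ?_, ?_⟩
        · rw [map_smul, map_sub, hgc, sub_self, smul_zero]
        · rw [map_smul, map_sub, hdc, hdw, ← smul_add]; simp
      have hmn : m n = hex.choose := by
        rw [hm n, if_neg (by omega), if_neg (by omega), dif_pos hex]
      obtain ⟨s1, s2, s3⟩ := hex.choose_spec
      rw [← hmn] at s1 s2 s3
      rw [hcongr n le_rfl] at s3
      exact ⟨s1, fun _ => s2, s3⟩
  exact ⟨m, m0, m1, fun i => (key i).1, fun i => (key i).2.2⟩

/-- In a formal DG-Lie algebra a cocycle of degree one whose square is exact is cohomologous to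
the leading coefficient of a formal Maurer-Cartan series. -/
theorem IsFormal.exists_formal_maurerCartan [CharZero K] {L : DGLieAlgebra.{u, v} K}
    (hL : IsFormal.{u, v, w₁, w₂} L) {x₁ x₂ : L.carrier} (hx₁ : x₁ ∈ L.cocycles 1)
    (hx₂ : x₂ ∈ L.deg 1) (hx : L.d x₂ + (1 / 2 : K) • L.bracket x₁ x₁ = 0) :
    ∃ y : ℕ → L.carrier, y 0 = 0 ∧ (∃ a ∈ L.deg 0, y 1 = x₁ + L.d a) ∧ (∀ i, y i ∈ L.deg 1) ∧
      ∀ i, L.d (y i) + (1 / 2 : K) • L.bracketCoeff y i = 0 := by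
  obtain ⟨M, H, f, g, hf, hg, hH⟩ := hL
  obtain ⟨m₁, hm₁, a, ha, hfm⟩ := hf.exists_lift hx₁
  have ha0 : a ∈ L.deg 0 := ha
  have hdx : L.d x₁ = 0 := hx₁.2
  have hdm : M.d m₁ = 0 := hm₁.2
  have hda : L.d a ∈ L.deg 1 := L.d_mem 0 a ha0
  have hdxx : L.d x₂ = -((1 / 2 : K) • L.bracket x₁ x₁) := eq_neg_of_add_eq_zero_left hx
  -- Expand `[x₁ + da, x₁ + da]`: `-2x₂` bounds `[x₁, x₁]`, `2[a, x₁]` bounds the cross terms, and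
  -- `[a, da]` bounds `[da, da]`.
  have hprim : f.toLin (M.bracket m₁ m₁) =
      L.d (-(2 : K) • x₂ + ((2 : K) • L.bracket a x₁ + L.bracket a (L.d a))) := by
    have e1 : L.d (L.bracket a x₁) = L.bracket (L.d a) x₁ := by
      simp [L.leibniz 0 a x₁ ha0, hdx]
    have e2 : L.d (L.bracket a (L.d a)) = L.bracket (L.d a) (L.d a) := by
      simp [L.leibniz 0 a (L.d a) ha0, L.d_d]
    rw [f.map_bracket, hfm]
    simp only [map_add, LinearMap.add_apply, map_smul, e1, e2, hdxx,
      L.bracket_comm_of_deg_one hx₁.1 hda]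
    module
  have hb : -(2 : K) • x₂ + ((2 : K) • L.bracket a x₁ + L.bracket a (L.d a)) ∈
      L.deg (2 - 1) := by
    refine Submodule.add_mem _ (Submodule.smul_mem _ _ hx₂) (Submodule.add_mem _
      (Submodule.smul_mem _ _ ?_) ?_)
    · exact L.bracket_mem 0 1 _ _ ha0 hx₁.1
    · exact L.bracket_mem 0 1 _ _ ha0 hda
  obtain ⟨c, -, hc⟩ := hf.exists_primitive (i := 2)
    ⟨M.bracket_mem_two hm₁.1 hm₁.1, by
      change M.d _ = 0
      rw [M.d_bracket_of_deg_one hm₁.1 hm₁.1, hdm]; simp⟩ hb hprim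
  have hsq : H.bracket (g.toLin m₁) (g.toLin m₁) = 0 := by
    rw [← g.map_bracket, ← hc, g.map_d, hH, LinearMap.zero_apply]
  obtain ⟨m, m0, m1, mdeg, mMC⟩ := DGLieAlgebra.exists_formal_maurerCartan hg hH hm₁ hsq
  refine ⟨fun i => f.toLin (m i), by simp [m0], ⟨a, ha0, by simp [m1, hfm]⟩,
    fun i => f.map_deg 1 _ (mdeg i), fun i => ?_⟩
  have := congrArg f.toLin (mMC i)
  simpa [bracketCoeff, f.map_d, f.map_bracket] using this

end DGLieAlgebra

/-! ### Coordinates on `K[t]/(t^n)` -/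

namespace TruncPoly

variable (K : Type u) [Field K]

/-- The class of the variable in `K[t]/(t^n)`. -/
noncomputable def t (n : ℕ) : TruncPoly K n := Ideal.Quotient.mk _ Polynomial.X

variable {K}

theorem t_pow_eq_zero {n i : ℕ} (h : n ≤ i) : t K n ^ i = 0 := by
  rw [t, ← map_pow, Ideal.Quotient.eq_zero_iff_mem, Ideal.mem_span_singleton]
  exact pow_dvd_pow _ h

theorem proj_t {m n : ℕ} (h : m ≤ n) : proj K h (t K n) = t K m := rfl

/-- The coefficient of `t^k` of an element of `K[t]/(t^n)`, for `k < n`. -/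
noncomputable def coeff {n k : ℕ} (h : k < n) : TruncPoly K n →ₗ[K] K :=
  Submodule.liftQ ((Ideal.span {(Polynomial.X : K[X]) ^ n}).restrictScalars K)
    (Polynomial.lcoeff K k) (by
      intro p hp
      have hp' : (Polynomial.X : K[X]) ^ n ∣ p := Ideal.mem_span_singleton.mp hp
      exact Polynomial.X_pow_dvd_iff.mp hp' k h)

theorem coeff_t_pow {n k : ℕ} (h : k < n) (i : ℕ) :
    coeff h (t K n ^ i) = if k = i then 1 else 0 := by
  have : coeff h (t K n ^ i) = (Polynomial.X ^ i : K[X]).coeff k := rfl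
  rw [this, Polynomial.coeff_X_pow]

theorem exists_eq_sum_t_pow {n : ℕ} (p : TruncPoly K n) :
    ∃ c : ℕ → K, p = ∑ i ∈ range n, c i • t K n ^ i := by
  obtain ⟨q, rfl⟩ := Ideal.Quotient.mk_surjective p
  refine ⟨q.coeff, ?_⟩
  have hmk : ∀ (c : K) (i : ℕ), c • t K n ^ i =
      Ideal.Quotient.mk (Ideal.span {(Polynomial.X : K[X]) ^ n}) (c • Polynomial.X ^ i) :=
    fun _ _ => rfl
  simp_rw [hmk]
  rw [← map_sum, Ideal.Quotient.eq, Ideal.mem_span_singleton, Polynomial.X_pow_dvd_iff]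
  intro d hd
  simp [Polynomial.coeff_X_pow, hd]

theorem t_pow_mem_maximalIdeal {n : ℕ} [NeZero n] {i : ℕ} (hi : i ≠ 0) :
    t K n ^ i ∈ IsLocalRing.maximalIdeal (TruncPoly K n) := by
  refine Ideal.pow_mem_of_mem _ ?_ i (Nat.pos_of_ne_zero hi)
  refine (IsLocalRing.maximalIdeal.isMaximal (TruncPoly K n)).isPrime.mem_of_pow_mem n ?_
  rw [t_pow_eq_zero le_rfl]
  exact Ideal.zero_mem _

theorem exists_eq_of_mem_maximalIdeal {p : TruncPoly K 3}
    (hp : p ∈ IsLocalRing.maximalIdeal (TruncPoly K 3)) :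
    ∃ a b : K, p = a • t K 3 ^ 1 + b • t K 3 ^ 2 := by
  obtain ⟨c, rfl⟩ := exists_eq_sum_t_pow p
  refine ⟨c 1, c 2, ?_⟩
  simp only [sum_range_succ, range_zero, sum_empty, zero_add, pow_zero] at hp ⊢
  -- A nonzero constant term would put a unit in the maximal ideal.
  suffices c 0 = 0 by simp [this]
  by_contra h0
  have h2 : c 0 • (1 : TruncPoly K 3) ∈ IsLocalRing.maximalIdeal (TruncPoly K 3) := by
    have := Ideal.sub_mem _ (Ideal.sub_mem _ hp
      (Submodule.smul_of_tower_mem _ (c 2) (t_pow_mem_maximalIdeal (K := K) two_ne_zero)))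
      (Submodule.smul_of_tower_mem _ (c 1) (t_pow_mem_maximalIdeal (K := K) one_ne_zero))
    simpa using this
  have h3 := Submodule.smul_of_tower_mem _ (c 0)⁻¹ h2
  rw [smul_smul, inv_mul_cancel₀ h0, one_smul] at h3
  exact (IsLocalRing.maximalIdeal.isMaximal (TruncPoly K 3)).ne_top
    ((Ideal.eq_top_iff_one _).mpr h3)

end TruncPoly

namespace DGLieAlgebra

open TruncPoly

variable {K : Type u} [Field K] (L : DGLieAlgebra.{u, v} K)

/-! ### Maurer-Cartan elements over `K[t]/(t^n)` -/

/-- The coefficient of `t^k` of an element of `L ⊗ K[t]/(t^n)`, for `k < n`. -/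
noncomputable def tensorCoeff {n k : ℕ} (h : k < n) :
    L.carrier ⊗[K] TruncPoly K n →ₗ[K] L.carrier :=
  (TensorProduct.rid K L.carrier).toLinearMap ∘ₗ (coeff h).lTensor L.carrier

theorem tensorCoeff_tmul {n k : ℕ} (h : k < n) (x : L.carrier) (i : ℕ) :
    L.tensorCoeff h (x ⊗ₜ[K] (t K n ^ i)) = if k = i then x else 0 := by
  simp [tensorCoeff, coeff_t_pow]

theorem tensorBracket_tmul {n : ℕ} (x y : L.carrier) (i j : ℕ) :
    L.tensorBracket (TruncPoly K n) (x ⊗ₜ[K] (t K n ^ i)) (y ⊗ₜ[K] (t K n ^ j)) =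
      L.bracket x y ⊗ₜ[K] (t K n ^ (i + j)) := by
  rw [pow_add]
  rfl

theorem tmul_t_pow_mem_tensorMax {n : ℕ} [NeZero n] {i : ℕ} (hi : i ≠ 0) {k : ℤ} {x : L.carrier}
    (hx : x ∈ L.deg k) : x ⊗ₜ[K] (t K n ^ i) ∈ L.tensorMax (TruncPoly K n) k :=
  ⟨(⟨x, hx⟩ : L.deg k) ⊗ₜ ⟨t K n ^ i, t_pow_mem_maximalIdeal hi⟩, rfl⟩

theorem exists_eq_of_mem_tensorMax {k : ℤ} {x : L.carrier ⊗[K] TruncPoly K 3}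
    (hx : x ∈ L.tensorMax (TruncPoly K 3) k) :
    ∃ x₁ ∈ L.deg k, ∃ x₂ ∈ L.deg k, x = x₁ ⊗ₜ[K] (t K 3 ^ 1) + x₂ ⊗ₜ[K] (t K 3 ^ 2) := by
  obtain ⟨z, rfl⟩ := hx
  induction z with
  | zero => exact ⟨0, Submodule.zero_mem _, 0, Submodule.zero_mem _, by simp⟩
  | add y z hy hz =>
    obtain ⟨y₁, hy₁, y₂, hy₂, hy⟩ := hy
    obtain ⟨z₁, hz₁, z₂, hz₂, hz⟩ := hz
    refine ⟨y₁ + z₁, Submodule.add_mem _ hy₁ hz₁, y₂ + z₂, Submodule.add_mem _ hy₂ hz₂, ?_⟩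
    rw [map_add, hy, hz, TensorProduct.add_tmul, TensorProduct.add_tmul]
    abel
  | tmul y p =>
    obtain ⟨a, b, hp⟩ := exists_eq_of_mem_maximalIdeal p.2
    refine ⟨a • y.1, Submodule.smul_mem _ _ y.2, b • y.1, Submodule.smul_mem _ _ y.2, ?_⟩
    change y.1 ⊗ₜ[K] p.1 = _
    rw [hp, TensorProduct.tmul_add, TensorProduct.smul_tmul, TensorProduct.smul_tmul]

/-- A Maurer-Cartan element over `K[t]/(t^3)` in coordinates. -/
theorem MaurerCartan.exists_eq (x : L.MaurerCartan (TruncPoly K 3)) :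
    ∃ x₁ ∈ L.cocycles 1, ∃ x₂ ∈ L.deg 1, x.1 = x₁ ⊗ₜ[K] (t K 3 ^ 1) + x₂ ⊗ₜ[K] (t K 3 ^ 2) ∧
      L.d x₂ + (1 / 2 : K) • L.bracket x₁ x₁ = 0 := by
  obtain ⟨x, hx, hMC⟩ := x
  obtain ⟨x₁, hx₁, x₂, hx₂, rfl⟩ := L.exists_eq_of_mem_tensorMax hx
  simp only [map_add, LinearMap.add_apply, tensorD, LinearMap.rTensor_tmul, tensorBracket_tmul,
    smul_add] at hMC
  have h1 := congrArg (L.tensorCoeff (show 1 < 3 by norm_num)) hMC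
  have h2 := congrArg (L.tensorCoeff (show 2 < 3 by norm_num)) hMC
  simp only [map_add, map_smul, tensorCoeff_tmul, map_zero] at h1 h2
  norm_num at h1 h2
  exact ⟨x₁, ⟨hx₁, h1⟩, x₂, hx₂, rfl, by simpa using h2⟩

/-- The truncation `∑ yᵢ tⁱ` of a formal series in `L ⊗ K[t]/(t^n)`. -/
noncomputable def truncSeries (y : ℕ → L.carrier) (n : ℕ) : L.carrier ⊗[K] TruncPoly K n :=
  ∑ i ∈ range n, y i ⊗ₜ[K] (t K n ^ i)

theorem truncSeries_mem {y : ℕ → L.carrier} (h0 : y 0 = 0) {k : ℤ} (hy : ∀ i, y i ∈ L.deg k)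
    (n : ℕ) [NeZero n] : L.truncSeries y n ∈ L.tensorMax (TruncPoly K n) k := by
  refine Submodule.sum_mem _ fun i _ => ?_
  rcases eq_or_ne i 0 with rfl | hi
  · simp [h0]
  · exact L.tmul_t_pow_mem_tensorMax hi (hy i)

theorem tensorD_truncSeries (y : ℕ → L.carrier) (n : ℕ) :
    L.tensorD (TruncPoly K n) (L.truncSeries y n) = L.truncSeries (fun i => L.d (y i)) n := by
  simp [truncSeries, tensorD]

/-- The Cauchy product modulo `t^n`: pairs with exponent sum at least `n` vanish, and the others are
grouped by that sum. -/
theorem tensorBracket_truncSeries (y : ℕ → L.carrier) (n : ℕ) :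
    L.tensorBracket (TruncPoly K n) (L.truncSeries y n) (L.truncSeries y n) =
      L.truncSeries (L.bracketCoeff y) n := by
  have h : L.tensorBracket (TruncPoly K n) (L.truncSeries y n) (L.truncSeries y n) =
      ∑ p ∈ range n ×ˢ range n, L.bracket (y p.1) (y p.2) ⊗ₜ[K] (t K n ^ (p.1 + p.2)) := by
    simp only [truncSeries, map_sum, LinearMap.sum_apply, tensorBracket_tmul]
    rw [Finset.sum_product_right]
  have h' : ∑ p ∈ range n ×ˢ range n with p.1 + p.2 < n,
      L.bracket (y p.1) (y p.2) ⊗ₜ[K] (t K n ^ (p.1 + p.2)) =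
        ∑ p ∈ range n ×ˢ range n, L.bracket (y p.1) (y p.2) ⊗ₜ[K] (t K n ^ (p.1 + p.2)) := by
    refine Finset.sum_filter_of_ne fun p _ hp => ?_
    by_contra hlt
    exact hp (by rw [t_pow_eq_zero (not_lt.mp hlt), TensorProduct.tmul_zero])
  rw [h, ← h', truncSeries, ← Finset.sum_fiberwise_of_maps_to (t := range n)
    (g := fun p : ℕ × ℕ => p.1 + p.2) (by simp)]
  refine Finset.sum_congr rfl fun k hk => ?_
  rw [bracketCoeff, TensorProduct.sum_tmul]
  have hk' := mem_range.mp hk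
  refine Finset.sum_congr ?_ fun p hp => ?_
  · ext p
    simp only [mem_filter, mem_product, mem_range, HasAntidiagonal.mem_antidiagonal]
    omega
  · rw [HasAntidiagonal.mem_antidiagonal.mp hp]

/-- The Maurer-Cartan element over `K[t]/(t^n)` defined by a formal Maurer-Cartan series. -/
noncomputable def MaurerCartan.ofSeries {y : ℕ → L.carrier} (h0 : y 0 = 0)
    (hy : ∀ i, y i ∈ L.deg 1) (hMC : ∀ i, L.d (y i) + (1 / 2 : K) • L.bracketCoeff y i = 0)
    (n : ℕ) [NeZero n] : L.MaurerCartan (TruncPoly K n) :=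
  ⟨L.truncSeries y n, L.truncSeries_mem h0 hy n, by
    rw [tensorD_truncSeries, tensorBracket_truncSeries, truncSeries, truncSeries,
      Finset.smul_sum, ← Finset.sum_add_distrib]
    refine Finset.sum_eq_zero fun i _ => ?_
    rw [TensorProduct.smul_tmul', ← TensorProduct.add_tmul, hMC, TensorProduct.zero_tmul]⟩

theorem baseMap_proj_tmul {m n : ℕ} (h : m ≤ n) (x : L.carrier) (i : ℕ) :
    L.baseMap (proj K h) (x ⊗ₜ[K] (t K n ^ i)) = x ⊗ₜ[K] (t K m ^ i) := by
  simp [baseMap, proj_t]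

theorem baseMap_truncSeries (y : ℕ → L.carrier) {m n : ℕ} (h : m ≤ n) :
    L.baseMap (proj K h) (L.truncSeries y n) = L.truncSeries y m := by
  simp only [truncSeries, map_sum, baseMap_proj_tmul]
  refine (Finset.sum_subset (range_mono h) fun i _ hi => ?_).symm
  rw [t_pow_eq_zero (by simpa using hi), TensorProduct.tmul_zero]

/-- The point of `Def_L(K[[t]])` defined by a formal Maurer-Cartan series. -/
noncomputable def DefPowerSeries.ofSeries {y : ℕ → L.carrier} (h0 : y 0 = 0)
    (hy : ∀ i, y i ∈ L.deg 1) (hMC : ∀ i, L.d (y i) + (1 / 2 : K) • L.bracketCoeff y i = 0) :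
    L.DefPowerSeries :=
  ⟨fun n _ => Quot.mk _ (MaurerCartan.ofSeries L h0 hy hMC n), fun _ _ _ _ h =>
    congrArg (Quot.mk _) (Subtype.ext (L.baseMap_truncSeries y h))⟩

/-- Over `K[t]/(t^2)` the gauge action is `e^{at} * xt = (x - da)t`. -/
theorem gauge_tmul_t (a x : L.carrier) :
    L.gauge (a ⊗ₜ[K] (t K 2 ^ 1)) (x ⊗ₜ[K] (t K 2 ^ 1)) = (x - L.d a) ⊗ₜ[K] (t K 2 ^ 1) := by
  have h0 : ∀ z : L.carrier,
      L.tensorBracket (TruncPoly K 2) (a ⊗ₜ[K] (t K 2 ^ 1)) (z ⊗ₜ[K] (t K 2 ^ 1)) = 0 := by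
    intro z
    rw [tensorBracket_tmul, t_pow_eq_zero le_rfl, TensorProduct.tmul_zero]
  have hd : L.tensorD (TruncPoly K 2) (a ⊗ₜ[K] (t K 2 ^ 1)) = L.d a ⊗ₜ[K] (t K 2 ^ 1) := by
    rw [tensorD, LinearMap.rTensor_tmul]
  -- All brackets vanish because `t² = 0`, so only `-da` in the term `n = 0` remains.
  rw [gauge, finsum_eq_single _ 0]
  · rw [h0, hd, pow_zero, Module.End.one_apply, TensorProduct.sub_tmul]
    simp [sub_eq_add_neg]
  · intro n hn
    obtain ⟨n, rfl⟩ := Nat.exists_eq_succ_of_ne_zero hn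
    rw [h0, hd, Nat.succ_eq_add_one,
      pow_succ (L.tensorBracket (TruncPoly K 2) _), Module.End.mul_apply, zero_sub, map_neg, h0]
    simp

end DGLieAlgebra

/-! ### Equality of the two images -/

theorem proposition8p1 {K : Type u} [Field K] [CharZero K] (L : DGLieAlgebra.{u, v} K)
    (hL : DGLieAlgebra.IsFormal.{u, v, w₁, w₂} L) :
    Set.range (DGLieAlgebra.Def.map L (TruncPoly.proj K (show 2 ≤ 3 by norm_num))) =
      Set.range (DGLieAlgebra.DefPowerSeries.eval L 2) := by
  apply Set.Subset.antisymm
  · rintro _ ⟨q, rfl⟩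
    obtain ⟨x, rfl⟩ := Quot.exists_rep q
    obtain ⟨x₁, hx₁, x₂, hx₂, hx, hMC⟩ := DGLieAlgebra.MaurerCartan.exists_eq L x
    obtain ⟨y, y0, ⟨a, ha, y1⟩, hy, hyMC⟩ := hL.exists_formal_maurerCartan hx₁ hx₂ hMC
    -- Since `y 1 = x₁ + da`, the gauge element `e^{at}` carries `y 1 t` to `x₁ t`.
    refine ⟨DGLieAlgebra.DefPowerSeries.ofSeries L y0 hy hyMC, Quot.sound
      ⟨a ⊗ₜ[K] (TruncPoly.t K 2 ^ 1), L.tmul_t_pow_mem_tensorMax one_ne_zero ha, ?_⟩⟩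
    change L.gauge _ (L.truncSeries y 2) = L.baseMap (TruncPoly.proj K _) x.1
    have h2 : L.truncSeries y 2 = y 1 ⊗ₜ[K] (TruncPoly.t K 2 ^ 1) := by
      simp [DGLieAlgebra.truncSeries, sum_range_succ, y0]
    rw [h2, L.gauge_tmul_t, y1, add_sub_cancel_right, hx, map_add, L.baseMap_proj_tmul,
      L.baseMap_proj_tmul, TruncPoly.t_pow_eq_zero (i := 2) le_rfl, TensorProduct.tmul_zero,
      add_zero]
  · rintro _ ⟨s, rfl⟩
    exact ⟨s.1 3, s.2 2 3 _⟩
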